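/- Let $p$ be an odd prime, let $\bar k$ be an algebraically closed field of characteristic different from $p$, and fix a generator $\gamma$ of the multiplicative group $\mathbb{F}_{p^2}^{\times}$. \emph{Necklaces.} Let $E/\bar k$ be an elliptic curve. Let $\mathcal C_\gamma\subset \mathrm{PGL}(E[p])$ be the set of classes having a representative in $\mathrm{GL}(E[p])$ whose characteristic polynomial is the minimal polynomial of $\gamma$ over $\mathbb{F}_p$. Consider lists $(C_0,C_1,\dots,C_p)$ of all the $p+1$ cyclic subgroups of order $p$ in $E[p]$, up to cyclic permutation. The class of $(C_0,\dots,C_p)$ is an \emph{oriented necklace} of $E$ if there is $h\in\mathcal C_\gamma$ with $h(C_i)=C_{i+1}$ for all $i=0,\dots,p-1$. Put $w(C_0,\dots,C_p)=(C_p,\dots,C_0)$; a \emph{necklace} of $E$ is a set $\{\mathfrak v,w(\mathfrak v)\}$ with $\mathfrak v$ an oriented necklace. \emph{Modular curves.} $Y(p)(\bar k)$ is the set of $\bar k$-isomorphism classes of pairs $(E,(P,Q))$, where $E/\bar k$ is an elliptic curve and $(P,Q)$ is an $\mathbb{F}_p$-basis of $E[p]$. The group $\mathrm{GL}_2(\mathbb{F}_p)$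 acts on the right on bases, and so on $Y(p)(\bar k)$, by $(P,Q)\cdot\begin{pmatrix}a&b\\c&d\end{pmatrix}=(aP+cQ,\,bP+dQ)$. For a subgroup $\mathcal G\le\mathrm{GL}_2(\mathbb{F}_p)$, $Y_{\mathcal G}(\bar k)$ is the set of $\mathcal G$-orbits in $Y(p)(\bar k)$. A non-split Cartan subgroup is the stabiliser in $\mathrm{GL}_2(\mathbb{F}_p)$ of a point $(1:\alpha)\in\mathbb{P}^1(\mathbb{F}_{p^2})$ with $\alpha\in\mathbb{F}_{p^2}\setminus\mathbb{F}_p$, for the right action $(x:y)\begin{pmatrix}a&b\\c&d\end{pmatrix}=(ax+cy:bx+dy)$. \emph{Proposition.} Let $\mathcal H$ be a non-split Cartan subgroup of $\mathrm{GL}_2(\mathbb{F}_p)$ and $\mathcal N$ its normaliser. There are bijections $$Y_{\mathcal H}(\bar k)\;\longrightarrow\;\{(E,\mathfrak v): E/\bar k \text{ an elliptic curve},\ \mathfrak v \text{ an oriented necklace of } E\}/\!\cong_{\bar k},$$ $$Y_{\mathcal N}(\bar k)\;\longrightarrow\;\{(E,\mathfrak v): E/\bar k \text{ an elliptic curve},\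 \mathfrak v \text{ a necklace of } E\}/\!\cong_{\bar k}.$$ More precisely, there is a family of surjective maps $\Phi_E$, one for each elliptic curve $E/\bar k$, from the set of bases of $E[p]$ to the set of oriented necklaces of $E$, such that: (i) $\Phi_{E'}(g(P),g(Q))=g(\Phi_E(P,Q))$ for all elliptic curves $E,E'$ over $\bar k$, every $\mathbb{F}_p$-linear isomorphism $g\colon E[p]\to E'[p]$ and every basis $(P,Q)$ of $E[p]$ (in particular $\Phi_E$ is $\mathrm{GL}(E[p])$-equivariant and compatible with isomorphisms of elliptic curves); (ii) for every $E$, two bases of $E[p]$ have the same image under $\Phi_E$ if and only if they lie in the same $\mathcal H$-orbit, and they have the same image under $(P,Q)\mapsto\{\Phi_E(P,Q),w(\Phi_E(P,Q))\}$ if and only if they lie in the same $\mathcal N$-orbit; (iii) the two bijections send the orbit of the class of $(E,(P,Q))$ to the class of $(E,\Phi_E(P,Q))$ and to the class of $(E,\{\Phi_E(P,Q),w(\Phi_E(P,Q))\})$, respectively. -/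

import Mathlib

universe u

namespace NonsplitCartan

/-! ## Elliptic curves over a field and their isomorphisms -/

/-- An elliptic curve over a field `k`, given by a Weierstrass equation of nonzero discriminant. -/
structure EllipticCurve (k : Type u) [Field k] where
  curve : WeierstrassCurve k
  [isElliptic : curve.IsElliptic]

attribute [instance] EllipticCurve.isElliptic

/-- The group `E(k)`. -/
abbrev EllipticCurve.Point {k : Type u} [Field k] (E : EllipticCurve k) : Type u :=
  E.curve.toAffine.Point

/-- An isomorphism `E ≅ E'` over `k` (preserving the origin): an admissible change of variables
`(x, y) ↦ (u²x + r, u³y + u²sx + t)` carrying the equation of `E'` to that of `E`. -/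
structure EllipticCurve.Iso {k : Type u} [Field k] (E E' : EllipticCurve k) where
  C : WeierstrassCurve.VariableChange k
  smul_eq : C • E'.curve = E.curve

section PointMap

variable {k : Type u} [Field k]

lemma coeff_relations (C : WeierstrassCurve.VariableChange k) (W W' : WeierstrassCurve k)
    (h : C • W' = W) :
    C.u * W.a₁ = W'.a₁ + 2 * C.s ∧
    (C.u : k) ^ 2 * W.a₂ = W'.a₂ - C.s * W'.a₁ + 3 * C.r - C.s ^ 2 ∧
    (C.u : k) ^ 3 * W.a₃ = W'.a₃ + C.r * W'.a₁ + 2 * C.t ∧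
    (C.u : k) ^ 4 * W.a₄ = W'.a₄ - C.s * W'.a₃ + 2 * C.r * W'.a₂
      - (C.t + C.r * C.s) * W'.a₁ + 3 * C.r ^ 2 - 2 * C.s * C.t ∧
    (C.u : k) ^ 6 * W.a₆ = W'.a₆ + C.r * W'.a₄ + C.r ^ 2 * W'.a₂ + C.r ^ 3 - C.t * W'.a₃
      - C.t ^ 2 - C.r * C.t * W'.a₁ := by
  subst h
  have hu : (C.u : k) ≠ 0 := C.u.ne_zero
  simp only [WeierstrassCurve.variableChange_def, Units.val_inv_eq_inv_val]
  refine ⟨?_, ?_, ?_, ?_, ?_⟩ <;> field_simp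

lemma nonsingular_image (C : WeierstrassCurve.VariableChange k) (W W' : WeierstrassCurve k)
    [W'.IsElliptic] (h : C • W' = W) {x y : k} (hxy : W.toAffine.Nonsingular x y) :
    W'.toAffine.Nonsingular ((C.u : k) ^ 2 * x + C.r)
      ((C.u : k) ^ 3 * y + (C.u : k) ^ 2 * C.s * x + C.t) := by
  obtain ⟨h1, h2, h3, h4, h6⟩ := coeff_relations C W W' h
  rw [← WeierstrassCurve.Affine.equation_iff_nonsingular, WeierstrassCurve.Affine.equation_iff]
  have he := hxy.left
  rw [WeierstrassCurve.Affine.equation_iff] at he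
  set u : k := (C.u : k)
  linear_combination u ^ 6 * he - u ^ 5 * x * y * h1 + u ^ 4 * x ^ 2 * h2 - u ^ 3 * y * h3
    + u ^ 2 * x * h4 + h6

/-- The map on points `(x, y) ↦ (u²x + r, u³y + u²sx + t)`, fixing the origin. -/
def pointMap (C : WeierstrassCurve.VariableChange k) (W W' : WeierstrassCurve k)
    [W'.IsElliptic] (h : C • W' = W) : W.toAffine.Point → W'.toAffine.Point
  | .zero => .zero
  | .some x y hxy => .some ((C.u : k) ^ 2 * x + C.r)
      ((C.u : k) ^ 3 * y + (C.u : k) ^ 2 * C.s * x + C.t) (nonsingular_image C W W' h hxy)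

lemma pointMap_one (W : WeierstrassCurve k) [W.IsElliptic]
    (h : (1 : WeierstrassCurve.VariableChange k) • W = W) (P : W.toAffine.Point) :
    pointMap 1 W W h P = P := by
  cases P with
  | zero => rfl
  | some x y hxy => simp [pointMap, WeierstrassCurve.VariableChange.one_def]

lemma pointMap_pointMap (C C' : WeierstrassCurve.VariableChange k) (W W' W'' : WeierstrassCurve k)
    [W'.IsElliptic] [W''.IsElliptic] (h : C • W' = W) (h' : C' • W'' = W')
    (h'' : (C * C') • W'' = W) (P : W.toAffine.Point) :
    pointMap C' W' W'' h' (pointMap C W W' h P) = pointMap (C * C') W W'' h'' P := by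
  cases P with
  | zero => rfl
  | some x y hxy =>
    simp only [pointMap, WeierstrassCurve.VariableChange.mul_def,
      WeierstrassCurve.Affine.Point.some.injEq, Units.val_mul]
    constructor <;> ring

lemma pointMap_comp (C D : WeierstrassCurve.VariableChange k) (hCD : C * D = 1)
    (W W' : WeierstrassCurve k) [W.IsElliptic] [W'.IsElliptic] (h : C • W' = W) (h' : D • W = W')
    (P : W.toAffine.Point) : pointMap D W' W h' (pointMap C W W' h P) = P := by
  rw [pointMap_pointMap C D W W' W h h' (by rw [hCD, one_smul])]
  simp only [hCD]
  exact pointMap_one W _ P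

lemma negY_image (C : WeierstrassCurve.VariableChange k) (W W' : WeierstrassCurve k)
    (h : C • W' = W) (x y : k) :
    W'.toAffine.negY ((C.u : k) ^ 2 * x + C.r)
      ((C.u : k) ^ 3 * y + (C.u : k) ^ 2 * C.s * x + C.t) =
    (C.u : k) ^ 3 * W.toAffine.negY x y + (C.u : k) ^ 2 * C.s * x + C.t := by
  obtain ⟨h1, -, h3, -, -⟩ := coeff_relations C W W' h
  simp only [WeierstrassCurve.Affine.negY]
  linear_combination (C.u : k) ^ 2 * x * h1 + h3

lemma slope_image [DecidableEq k] (C : WeierstrassCurve.VariableChange k)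
    (W W' : WeierstrassCurve k) (h : C • W' = W) {x₁ x₂ y₁ y₂ : k}
    (h₁ : W.toAffine.Equation x₁ y₁) (h₂ : W.toAffine.Equation x₂ y₂)
    (hxy : ¬(x₁ = x₂ ∧ y₁ = W.toAffine.negY x₂ y₂)) :
    W'.toAffine.slope ((C.u : k) ^ 2 * x₁ + C.r) ((C.u : k) ^ 2 * x₂ + C.r)
      ((C.u : k) ^ 3 * y₁ + (C.u : k) ^ 2 * C.s * x₁ + C.t)
      ((C.u : k) ^ 3 * y₂ + (C.u : k) ^ 2 * C.s * x₂ + C.t) =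
    C.u * W.toAffine.slope x₁ x₂ y₁ y₂ + C.s := by
  obtain ⟨h1, h2, h3, h4, -⟩ := coeff_relations C W W' h
  have hu : (C.u : k) ≠ 0 := C.u.ne_zero
  by_cases hx : x₁ = x₂
  · subst hx
    have hy : y₁ ≠ W.toAffine.negY x₁ y₂ := fun e => hxy ⟨rfl, e⟩
    obtain rfl := WeierstrassCurve.Affine.Y_eq_of_Y_ne h₁ h₂ rfl hy
    have hd : y₁ - W.toAffine.negY x₁ y₁ ≠ 0 := sub_ne_zero.mpr hy
    have hd' : ((C.u : k) ^ 3 * y₁ + (C.u : k) ^ 2 * C.s * x₁ + C.t) -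
        W'.toAffine.negY ((C.u : k) ^ 2 * x₁ + C.r)
          ((C.u : k) ^ 3 * y₁ + (C.u : k) ^ 2 * C.s * x₁ + C.t) =
        (C.u : k) ^ 3 * (y₁ - W.toAffine.negY x₁ y₁) := by
      rw [negY_image C W W' h]; ring
    have hd'' : (C.u : k) ^ 3 * (y₁ - W.toAffine.negY x₁ y₁) ≠ 0 :=
      mul_ne_zero (pow_ne_zero _ hu) hd
    rw [WeierstrassCurve.Affine.slope_of_Y_ne rfl (by rw [← sub_ne_zero, hd']; exact hd''),
      WeierstrassCurve.Affine.slope_of_Y_ne rfl hy, hd', div_eq_iff hd'', add_mul,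
      show (C.u : k) * ((3 * x₁ ^ 2 + 2 * W.a₂ * x₁ + W.a₄ - W.a₁ * y₁) /
        (y₁ - W.toAffine.negY x₁ y₁)) * ((C.u : k) ^ 3 * (y₁ - W.toAffine.negY x₁ y₁)) =
        (C.u : k) ^ 4 * (3 * x₁ ^ 2 + 2 * W.a₂ * x₁ + W.a₄ - W.a₁ * y₁) by field_simp]
    simp only [WeierstrassCurve.Affine.negY]
    set u : k := (C.u : k)
    linear_combination -(2 * u ^ 2 * x₁ * h2) - h4 + u ^ 3 * y₁ * h1 - C.s * u ^ 2 * x₁ * h1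
      - C.s * h3
  · have hx' : (C.u : k) ^ 2 * x₁ + C.r ≠ (C.u : k) ^ 2 * x₂ + C.r := fun e =>
      hx (mul_left_cancel₀ (pow_ne_zero 2 hu) (add_right_cancel e))
    have hd : x₁ - x₂ ≠ 0 := sub_ne_zero.mpr hx
    rw [WeierstrassCurve.Affine.slope_of_X_ne hx', WeierstrassCurve.Affine.slope_of_X_ne hx,
      div_eq_iff (sub_ne_zero.mpr hx')]
    field_simp
    ring

lemma pointMap_add [DecidableEq k] (C : WeierstrassCurve.VariableChange k)
    (W W' : WeierstrassCurve k) [W'.IsElliptic] (h : C • W' = W)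
    (P Q : W.toAffine.Point) :
    pointMap C W W' h (P + Q) = pointMap C W W' h P + pointMap C W W' h Q := by
  have hu : (C.u : k) ≠ 0 := C.u.ne_zero
  obtain ⟨h1, h2, h3, -, -⟩ := coeff_relations C W W' h
  cases P with
  | zero =>
    change pointMap C W W' h (0 + Q) = 0 + pointMap C W W' h Q
    rw [zero_add, zero_add]
  | some x₁ y₁ hP =>
    cases Q with
    | zero =>
      change pointMap C W W' h (_ + 0) = pointMap C W W' h _ + 0
      rw [add_zero, add_zero]
    | some x₂ y₂ hQ =>
      by_cases hxy : x₁ = x₂ ∧ y₁ = W.toAffine.negY x₂ y₂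
      · rw [WeierstrassCurve.Affine.Point.add_of_Y_eq hxy.1 hxy.2]
        simp only [pointMap]
        rw [WeierstrassCurve.Affine.Point.add_of_Y_eq]
        · rfl
        · rw [hxy.1]
        · rw [negY_image C W W' h, hxy.2, hxy.1]
      · rw [WeierstrassCurve.Affine.Point.add_some hxy]
        simp only [pointMap]
        rw [WeierstrassCurve.Affine.Point.add_some]
        · have hX : W'.toAffine.addX ((C.u : k) ^ 2 * x₁ + C.r) ((C.u : k) ^ 2 * x₂ + C.r)
              (C.u * W.toAffine.slope x₁ x₂ y₁ y₂ + C.s) =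
              (C.u : k) ^ 2 * W.toAffine.addX x₁ x₂ (W.toAffine.slope x₁ x₂ y₁ y₂) + C.r := by
            simp only [WeierstrassCurve.Affine.addX]
            generalize W.toAffine.slope x₁ x₂ y₁ y₂ = l
            linear_combination -((C.u : k) * l * h1) + h2
          simp only [WeierstrassCurve.Affine.Point.some.injEq,
            slope_image C W W' h hP.left hQ.left hxy, WeierstrassCurve.Affine.addY,
            WeierstrassCurve.Affine.negAddY, hX, true_and]
          rw [← negY_image C W W' h]
          congr 1
          ring
        · rintro ⟨e₁, e₂⟩
          have hx : x₁ = x₂ := mul_left_cancel₀ (pow_ne_zero 2 hu) (add_right_cancel e₁)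
          refine hxy ⟨hx, ?_⟩
          rw [negY_image C W W' h, hx] at e₂
          exact mul_left_cancel₀ (pow_ne_zero 3 hu) (add_right_cancel (add_right_cancel e₂))

end PointMap

namespace EllipticCurve.Iso

variable {k : Type u} [Field k] {E E' E'' : EllipticCurve k}

/-- The identity isomorphism. -/
def refl (E : EllipticCurve k) : Iso E E := ⟨1, one_smul _ _⟩

/-- The inverse isomorphism. -/
def symm (f : Iso E E') : Iso E' E := ⟨f.C⁻¹, by rw [← f.smul_eq, inv_smul_smul]⟩

/-- The composite isomorphism. -/
def trans (f : Iso E E') (g : Iso E' E'') : Iso E E'' :=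
  ⟨f.C * g.C, by rw [mul_smul, g.smul_eq, f.smul_eq]⟩

variable [DecidableEq k]

/-- The group isomorphism `E(k) ≃ E'(k)` induced by an isomorphism of elliptic curves. -/
def pointEquiv (f : Iso E E') : E.Point ≃+ E'.Point where
  toFun := pointMap f.C _ _ f.smul_eq
  invFun := pointMap f.C⁻¹ _ _ f.symm.smul_eq
  left_inv := pointMap_comp f.C f.C⁻¹ (mul_inv_cancel _) _ _ _ _
  right_inv := pointMap_comp f.C⁻¹ f.C (inv_mul_cancel _) _ _ _ _
  map_add' := pointMap_add f.C _ _ f.smul_eq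

end EllipticCurve.Iso

/-! ## The `p`-torsion and full level structures -/

/-- The `p`-torsion subgroup `A[p]`. -/
abbrev Torsion (p : ℕ) (A : Type u) [AddCommGroup A] : AddSubgroup A :=
  AddSubgroup.torsionBy A (p : ℤ)

/-- `A[p]` is an `𝔽_p`-vector space. -/
noncomputable instance Torsion.module (p : ℕ) (A : Type u) [AddCommGroup A] :
    Module (ZMod p) (Torsion p A) :=
  AddSubgroup.torsionBy.zmodModule

/-- The isomorphism `A[p] ≃ B[p]` obtained by restricting an isomorphism `A ≃ B`. -/
noncomputable def torsionEquiv (p : ℕ) {A B : Type u} [AddCommGroup A] [AddCommGroup B]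
    (e : A ≃+ B) : Torsion p A ≃ₗ[ZMod p] Torsion p B where
  toFun P := ⟨e P, by
    rw [AddSubgroup.torsionBy.nsmul_iff, ← map_nsmul,
      AddSubgroup.torsionBy.nsmul_iff.mp P.2, map_zero]⟩
  invFun P := ⟨e.symm P, by
    rw [AddSubgroup.torsionBy.nsmul_iff, ← map_nsmul,
      AddSubgroup.torsionBy.nsmul_iff.mp P.2, map_zero]⟩
  left_inv P := by simp
  right_inv P := by simp
  map_add' P Q := by ext; simp
  map_smul' c P := ZMod.map_smul (AddMonoidHom.mk' (fun P : Torsion p A => (⟨e P, by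
    rw [AddSubgroup.torsionBy.nsmul_iff, ← map_nsmul,
      AddSubgroup.torsionBy.nsmul_iff.mp P.2, map_zero]⟩ : Torsion p B))
    (fun P Q => by ext; simp)) c P

section Curves

variable (p : ℕ) {k : Type u} [Field k] [DecidableEq k]

/-- The isomorphism `E[p] ≃ E'[p]` induced by an isomorphism `E ≅ E'`. -/
noncomputable def EllipticCurve.Iso.torsion {E E' : EllipticCurve k} (f : E.Iso E') :
    Torsion p E.Point ≃ₗ[ZMod p] Torsion p E'.Point :=
  torsionEquiv p f.pointEquiv

lemma EllipticCurve.Iso.torsion_refl (E : EllipticCurve k) :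
    (EllipticCurve.Iso.refl E).torsion p = LinearEquiv.refl (ZMod p) _ := by
  ext P
  exact pointMap_one E.curve (one_smul _ _) _

lemma EllipticCurve.Iso.torsion_trans {E E' E'' : EllipticCurve k} (f : E.Iso E')
    (g : E'.Iso E'') : (f.trans g).torsion p = (f.torsion p).trans (g.torsion p) := by
  ext P
  exact (pointMap_pointMap f.C g.C _ _ _ f.smul_eq g.smul_eq (f.trans g).smul_eq _).symm

lemma EllipticCurve.Iso.torsion_symm {E E' : EllipticCurve k} (f : E.Iso E') :
    f.symm.torsion p = (f.torsion p).symm := by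
  ext P
  rfl

/-- An `𝔽_p`-basis `(P, Q)` of `E[p]`. -/
abbrev LevelBasis (E : EllipticCurve k) : Type u :=
  Module.Basis (Fin 2) (ZMod p) (Torsion p E.Point)

end Curves

/-- The right action `(P, Q) · (a, b; c, d) = (aP + cQ, bP + dQ)` on bases of a plane `V`. -/
noncomputable def basisMul {p : ℕ} {V : Type u} [AddCommGroup V] [Module (ZMod p) V]
    (b : Module.Basis (Fin 2) (ZMod p) V) (M : GL (Fin 2) (ZMod p)) :
    Module.Basis (Fin 2) (ZMod p) V :=
  b.map (LinearMap.GeneralLinearGroup.generalLinearEquiv (ZMod p) V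
    (Matrix.GeneralLinearGroup.toLin' b M))

section BasisMul

variable {p : ℕ} {V V' : Type u} [AddCommGroup V] [Module (ZMod p) V] [AddCommGroup V']
  [Module (ZMod p) V']

lemma basisMul_apply (b : Module.Basis (Fin 2) (ZMod p) V) (M : GL (Fin 2) (ZMod p)) (j : Fin 2) :
    basisMul b M j = M.1 0 j • b 0 + M.1 1 j • b 1 := by
  have h : basisMul b M j = (Matrix.GeneralLinearGroup.toLin' b M).toLinearEquiv (b j) := rfl
  rw [h, Matrix.GeneralLinearGroup.toLin'_apply, Fintype.linearCombination_apply]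
  simp [Fin.sum_univ_two, Matrix.mulVec, dotProduct, Finsupp.single_apply]

lemma basisMul_one (b : Module.Basis (Fin 2) (ZMod p) V) : basisMul b 1 = b := by
  refine Module.Basis.eq_of_apply_eq fun j => ?_
  rw [basisMul_apply]
  fin_cases j <;> simp

lemma basisMul_mul (b : Module.Basis (Fin 2) (ZMod p) V) (M N : GL (Fin 2) (ZMod p)) :
    basisMul b (M * N) = basisMul (basisMul b M) N := by
  refine Module.Basis.eq_of_apply_eq fun j => ?_
  simp only [basisMul_apply, Units.val_mul, Matrix.mul_apply, Fin.sum_univ_two]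
  module

lemma basisMul_map (b : Module.Basis (Fin 2) (ZMod p) V) (M : GL (Fin 2) (ZMod p))
    (f : V ≃ₗ[ZMod p] V') : basisMul (b.map f) M = (basisMul b M).map f := by
  refine Module.Basis.eq_of_apply_eq fun j => ?_
  simp [basisMul_apply]

end BasisMul

/-! ## The points of the modular curves `Y(p)` and `Y_H` over an algebraically closed field -/

section ModularCurve

variable (p : ℕ) (k : Type u) [Field k] [DecidableEq k]

/-- Isomorphism of pairs `(E, (P, Q))`. -/
instance fullLevelSetoid : Setoid (Σ E : EllipticCurve k, LevelBasis p E) where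
  r x y := ∃ f : x.1.Iso y.1, x.2.map (f.torsion p) = y.2
  iseqv :=
    { refl := fun x => ⟨.refl x.1, by rw [EllipticCurve.Iso.torsion_refl]; ext; rfl⟩
      symm := by
        rintro x y ⟨f, hf⟩
        refine ⟨f.symm, ?_⟩
        rw [← hf, EllipticCurve.Iso.torsion_symm]
        refine Module.Basis.eq_of_apply_eq fun j => ?_
        simp
      trans := by
        rintro x y z ⟨f, hf⟩ ⟨g, hg⟩
        refine ⟨f.trans g, ?_⟩
        rw [← hg, ← hf, EllipticCurve.Iso.torsion_trans]
        rfl }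

/-- `Y(p)(k)`: isomorphism classes of pairs `(E, (P, Q))` with `(P, Q)` a basis of `E[p]`. -/
def FullLevel : Type u := Quotient (fullLevelSetoid p k)

variable {k} in
/-- The isomorphism class of `(E, (P, Q))`. -/
def FullLevel.mk (E : EllipticCurve k) (b : LevelBasis p E) : FullLevel p k :=
  Quotient.mk (fullLevelSetoid p k) ⟨E, b⟩

/-- The right action of `GL₂(𝔽_p)` on `Y(p)(k)`, `(E, (P, Q)) ↦ (E, (P, Q) · M)`. -/
noncomputable instance : MulAction (GL (Fin 2) (ZMod p))ᵐᵒᵖ (FullLevel p k) where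
  smul M := Quotient.map (fun x => ⟨x.1, basisMul x.2 M.unop⟩) (by
    rintro x y ⟨f, hf⟩
    exact ⟨f, by rw [← hf, basisMul_map]⟩)
  one_smul := by
    rintro ⟨x⟩
    exact congrArg (FullLevel.mk p x.1) (basisMul_one x.2)
  mul_smul := by
    rintro M N ⟨x⟩
    exact congrArg (FullLevel.mk p x.1) (basisMul_mul x.2 N.unop M.unop)

/-- `Y_H(k)`: the `H`-orbits on `Y(p)(k)`. -/
noncomputable def ModularCurvePoints (H : Subgroup (GL (Fin 2) (ZMod p))) : Type u :=
  MulAction.orbitRel.Quotient H.op (FullLevel p k)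

variable {k} in
/-- The `H`-orbit of the isomorphism class of `(E, (P, Q))`. -/
noncomputable def ModularCurvePoints.mk (H : Subgroup (GL (Fin 2) (ZMod p))) (E : EllipticCurve k)
    (b : LevelBasis p E) : ModularCurvePoints p k H :=
  Quotient.mk (MulAction.orbitRel H.op (FullLevel p k)) (FullLevel.mk p E b)

end ModularCurve

/-! ## Non-split Cartan subgroups -/

/-- `H` is the stabiliser of the point `(1 : α)` of `ℙ¹(𝔽_{p²}) ∖ ℙ¹(𝔽_p)`, for some
`α ∈ 𝔽_{p²} ∖ 𝔽_p`, under the right action `(x : y) · (a, b; c, d) = (ax + cy : bx + dy)`. -/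
def IsNonsplitCartan (p : ℕ) [Fact p.Prime] (H : Subgroup (GL (Fin 2) (ZMod p))) : Prop :=
  ∃ α : GaloisField p 2, α ∉ Set.range (algebraMap (ZMod p) (GaloisField p 2)) ∧
    ∀ M : GL (Fin 2) (ZMod p), M ∈ H ↔ ∃ c : (GaloisField p 2)ˣ,
      Matrix.vecMul ![1, α] (M.1.map (algebraMap (ZMod p) (GaloisField p 2))) =
        (c : GaloisField p 2) • ![1, α]

/-! ## Necklaces -/

section Necklaces

variable (p : ℕ) (V V' V'' : Type u) [AddCommGroup V] [Module (ZMod p) V]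
  [AddCommGroup V'] [Module (ZMod p) V'] [AddCommGroup V''] [Module (ZMod p) V'']

/-- The cyclic subgroups of order `p` of `V`. -/
def Pearl : Type u := {C : AddSubgroup V // IsAddCyclic C ∧ Nat.card C = p}

/-- Lists `(C₀, …, C_p)` of all the cyclic subgroups of order `p`, each occurring once. -/
abbrev PearlList : Type u := Fin (p + 1) ≃ Pearl p V

/-- Two lists are equivalent if one is a cyclic permutation of the other. -/
instance cyclicSetoid : Setoid (PearlList p V) where
  r C C' := ∃ j : Fin (p + 1), ∀ i, C' i = C (i + j)
  iseqv :=
    { refl := fun C => ⟨0, fun i => by rw [add_zero]⟩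
      symm := by
        rintro C C' ⟨j, h⟩
        exact ⟨-j, fun i => by rw [h, neg_add_cancel_right]⟩
      trans := by
        rintro C C' C'' ⟨j, h⟩ ⟨j', h'⟩
        exact ⟨j' + j, fun i => by rw [h', h, add_assoc]⟩ }

/-- Lists of pearls up to cyclic permutation. -/
def CyclicList : Type u := Quotient (cyclicSetoid p V)

variable {p V V' V''}

lemma rev_add (i j : Fin (p + 1)) : i.rev + j = (i + -j).rev := by
  have h : ∀ a : Fin (p + 1), a.rev = Fin.last p - a := fun a => (Fin.last_sub a).symm
  rw [h, h]
  abel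

/-- The involution `w (C₀, …, C_p) = (C_p, …, C₀)`. -/
def CyclicList.w : CyclicList p V → CyclicList p V :=
  Quotient.map (fun C => Fin.revPerm.trans C) (by
    rintro C C' ⟨j, h⟩
    exact ⟨-j, fun i => by simp [h, rev_add]⟩)

/-- The image of a pearl under a linear isomorphism. -/
def Pearl.map (f : V ≃ₗ[ZMod p] V') (C : Pearl p V) : Pearl p V' :=
  ⟨C.1.map (f.toAddEquiv : V →+ V'), by
    have e : C.1 ≃+ C.1.map (f.toAddEquiv : V →+ V') := f.toAddEquiv.addSubgroupMap C.1
    have := C.2.1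
    exact ⟨isAddCyclic_of_surjective e e.surjective,
      (Nat.card_congr e.toEquiv).symm.trans C.2.2⟩⟩

lemma Pearl.map_refl (C : Pearl p V) : C.map (LinearEquiv.refl (ZMod p) V) = C :=
  Subtype.ext (AddSubgroup.map_id C.1)

lemma Pearl.map_trans (f : V ≃ₗ[ZMod p] V') (g : V' ≃ₗ[ZMod p] V'') (C : Pearl p V) :
    C.map (f.trans g) = (C.map f).map g :=
  Subtype.ext (AddSubgroup.map_map C.1 (g.toAddEquiv : V' →+ V'') (f.toAddEquiv : V →+ V')).symm

/-- The bijection on pearls induced by a linear isomorphism. -/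
def Pearl.congr (f : V ≃ₗ[ZMod p] V') : Pearl p V ≃ Pearl p V' where
  toFun := Pearl.map f
  invFun := Pearl.map f.symm
  left_inv C := by rw [← Pearl.map_trans, LinearEquiv.self_trans_symm, Pearl.map_refl]
  right_inv C := by rw [← Pearl.map_trans, LinearEquiv.symm_trans_self, Pearl.map_refl]

/-- `f (C₀, …, C_p) = (f C₀, …, f C_p)`. -/
def CyclicList.map (f : V ≃ₗ[ZMod p] V') : CyclicList p V → CyclicList p V' :=
  Quotient.map (fun C => C.trans (Pearl.congr f)) (by
    rintro C C' ⟨j, h⟩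
    exact ⟨j, fun i => congrArg (Pearl.map f) (h i)⟩)

lemma CyclicList.map_refl (v : CyclicList p V) : v.map (LinearEquiv.refl (ZMod p) V) = v := by
  obtain ⟨C⟩ := v
  exact congrArg (Quotient.mk _) (Equiv.ext fun i => Pearl.map_refl (C i))

lemma CyclicList.map_trans (f : V ≃ₗ[ZMod p] V') (g : V' ≃ₗ[ZMod p] V'') (v : CyclicList p V) :
    v.map (f.trans g) = (v.map f).map g := by
  obtain ⟨C⟩ := v
  exact congrArg (Quotient.mk _) (Equiv.ext fun i => Pearl.map_trans f g (C i))

lemma CyclicList.map_w (f : V ≃ₗ[ZMod p] V') (v : CyclicList p V) : v.w.map f = (v.map f).w := by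
  obtain ⟨C⟩ := v
  rfl

variable [Fact p.Prime]

/-- `V` is a plane and the class of `h` in `PGL(V)` belongs to `𝒞_γ`: some representative, that is
some `𝔽_p^×`-multiple of `h`, has the minimal polynomial of `γ` as its characteristic polynomial
(computed in a basis of `V`). -/
def InClass (γ : (GaloisField p 2)ˣ) (h : V ≃ₗ[ZMod p] V) : Prop :=
  ∃ (b : Module.Basis (Fin 2) (ZMod p) V) (c : (ZMod p)ˣ),
    (LinearMap.toMatrix b b ((c : ZMod p) • (h : V →ₗ[ZMod p] V))).charpoly =
      minpoly (ZMod p) (γ : GaloisField p 2)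

/-- A list up to cyclic permutation is an oriented necklace if it is turned by one step
by an element `h` of the class `𝒞_γ`. -/
def IsOrientedNecklace (γ : (GaloisField p 2)ˣ) (v : CyclicList p V) : Prop :=
  ∃ C : PearlList p V, Quotient.mk _ C = v ∧ ∃ h : V ≃ₗ[ZMod p] V, InClass γ h ∧
    ∀ i : Fin p, (C i.castSucc).map h = C i.succ

lemma InClass.conj {γ : (GaloisField p 2)ˣ} {h : V ≃ₗ[ZMod p] V} (H : InClass γ h)
    (f : V ≃ₗ[ZMod p] V') : InClass γ (f.symm.trans (h.trans f)) := by
  obtain ⟨b, c, hb⟩ := H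
  refine ⟨b.map f, c, ?_⟩
  rw [← hb]
  congr 1
  ext i j
  simp [LinearMap.toMatrix_apply]

lemma IsOrientedNecklace.map {γ : (GaloisField p 2)ˣ} {v : CyclicList p V}
    (hv : IsOrientedNecklace γ v) (f : V ≃ₗ[ZMod p] V') : IsOrientedNecklace γ (v.map f) := by
  obtain ⟨C, rfl, h, hh, hC⟩ := hv
  refine ⟨C.trans (Pearl.congr f), rfl, f.symm.trans (h.trans f), hh.conj f, fun i => ?_⟩
  change ((C i.castSucc).map f).map _ = (C i.succ).map f
  rw [← hC, ← Pearl.map_trans, ← Pearl.map_trans]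
  congr 1
  ext x
  simp

variable (p V) in
/-- The oriented `γ`-necklaces of `V`. -/
def OrientedNecklace (γ : (GaloisField p 2)ˣ) : Type u :=
  {v : CyclicList p V // IsOrientedNecklace γ v}

variable (p V) in
/-- The `γ`-necklaces of `V`: the sets `{v, w v}` with `v` an oriented `γ`-necklace. -/
def Necklace (γ : (GaloisField p 2)ˣ) : Type u :=
  {s : Set (CyclicList p V) // ∃ v, IsOrientedNecklace γ v ∧ s = {v, v.w}}

variable {γ : (GaloisField p 2)ˣ}

/-- The necklace `{v, w v}` underlying an oriented necklace `v`. -/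
def OrientedNecklace.toNecklace (v : OrientedNecklace p V γ) : Necklace p V γ :=
  ⟨{v.1, v.1.w}, v.1, v.2, rfl⟩

/-- The image of an oriented necklace under a linear isomorphism. -/
def OrientedNecklace.map (f : V ≃ₗ[ZMod p] V') (v : OrientedNecklace p V γ) :
    OrientedNecklace p V' γ :=
  ⟨v.1.map f, v.2.map f⟩

/-- The image of a necklace under a linear isomorphism. -/
def Necklace.map (f : V ≃ₗ[ZMod p] V') (s : Necklace p V γ) : Necklace p V' γ :=
  ⟨CyclicList.map f '' s.1, by
    obtain ⟨v, hv, hs⟩ := s.2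
    exact ⟨v.map f, hv.map f, by rw [hs, Set.image_pair, CyclicList.map_w]⟩⟩

lemma OrientedNecklace.map_refl (v : OrientedNecklace p V γ) :
    v.map (LinearEquiv.refl (ZMod p) V) = v :=
  Subtype.ext v.1.map_refl

lemma OrientedNecklace.map_trans (f : V ≃ₗ[ZMod p] V') (g : V' ≃ₗ[ZMod p] V'')
    (v : OrientedNecklace p V γ) : v.map (f.trans g) = (v.map f).map g :=
  Subtype.ext (v.1.map_trans f g)

lemma Necklace.map_refl (s : Necklace p V γ) : s.map (LinearEquiv.refl (ZMod p) V) = s :=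
  Subtype.ext (by simp [Necklace.map, CyclicList.map_refl])

lemma Necklace.map_trans (f : V ≃ₗ[ZMod p] V') (g : V' ≃ₗ[ZMod p] V'')
    (s : Necklace p V γ) : s.map (f.trans g) = (s.map f).map g :=
  Subtype.ext (by simp [Necklace.map, CyclicList.map_trans, Set.image_image])

end Necklaces

/-! ## Elliptic curves with a necklace, up to isomorphism -/

section Moduli

variable {p : ℕ} [Fact p.Prime] (γ : (GaloisField p 2)ˣ) (k : Type u) [Field k] [DecidableEq k]

/-- Isomorphism of pairs `(E, v)` with `v` an oriented necklace on `E`. -/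
instance orientedNecklaceSetoid :
    Setoid (Σ E : EllipticCurve k, OrientedNecklace p (Torsion p E.Point) γ) where
  r x y := ∃ f : x.1.Iso y.1, x.2.map (f.torsion p) = y.2
  iseqv :=
    { refl := fun x => ⟨.refl x.1, by
        rw [EllipticCurve.Iso.torsion_refl, OrientedNecklace.map_refl]⟩
      symm := by
        rintro x y ⟨f, hf⟩
        refine ⟨f.symm, ?_⟩
        rw [← hf, EllipticCurve.Iso.torsion_symm, ← OrientedNecklace.map_trans,
          LinearEquiv.self_trans_symm, OrientedNecklace.map_refl]
      trans := by
        rintro x y z ⟨f, hf⟩ ⟨g, hg⟩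
        refine ⟨f.trans g, ?_⟩
        rw [← hg, ← hf, EllipticCurve.Iso.torsion_trans, OrientedNecklace.map_trans] }

/-- Isomorphism of pairs `(E, v)` with `v` a necklace on `E`. -/
instance necklaceSetoid :
    Setoid (Σ E : EllipticCurve k, Necklace p (Torsion p E.Point) γ) where
  r x y := ∃ f : x.1.Iso y.1, x.2.map (f.torsion p) = y.2
  iseqv :=
    { refl := fun x => ⟨.refl x.1, by
        rw [EllipticCurve.Iso.torsion_refl, Necklace.map_refl]⟩
      symm := by
        rintro x y ⟨f, hf⟩
        refine ⟨f.symm, ?_⟩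
        rw [← hf, EllipticCurve.Iso.torsion_symm, ← Necklace.map_trans,
          LinearEquiv.self_trans_symm, Necklace.map_refl]
      trans := by
        rintro x y z ⟨f, hf⟩ ⟨g, hg⟩
        refine ⟨f.trans g, ?_⟩
        rw [← hg, ← hf, EllipticCurve.Iso.torsion_trans, Necklace.map_trans] }

/-- Isomorphism classes of elliptic curves over `k` with an oriented `γ`-necklace. -/
def OrientedNecklaceClass : Type u := Quotient (orientedNecklaceSetoid γ k)

/-- Isomorphism classes of elliptic curves over `k` with a `γ`-necklace. -/
def NecklaceClass : Type u := Quotient (necklaceSetoid γ k)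

variable {γ k}

/-- The isomorphism class of `(E, v)`, with `v` an oriented necklace. -/
def OrientedNecklaceClass.mk (E : EllipticCurve k)
    (v : OrientedNecklace p (Torsion p E.Point) γ) : OrientedNecklaceClass γ k :=
  Quotient.mk (orientedNecklaceSetoid γ k) ⟨E, v⟩

/-- The isomorphism class of `(E, v)`, with `v` a necklace. -/
def NecklaceClass.mk (E : EllipticCurve k)
    (v : Necklace p (Torsion p E.Point) γ) : NecklaceClass γ k :=
  Quotient.mk (necklaceSetoid γ k) ⟨E, v⟩

end Moduli

end NonsplitCartan

open NonsplitCartan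

/-!
A list of the `p + 1` lines of a plane `V` over `𝔽_p`, taken up to cyclic permutation, is the same
thing as the permutation of the lines that moves each entry to the next one (its *rotation*,
`CyclicList.rotation_injective`). Reversing the list inverts the rotation, a linear isomorphism
conjugates it, and the list is an oriented necklace exactly when its rotation is induced by an
element of `𝒞_γ`.

The model plane is the field `L` with `p ^ 2` elements, in which multiplication by the generator `γ`
permutes the lines in a single cycle; this is the standard necklace `v`
(`exists_rotation_eq_congr_mulEquiv`).

* An automorphism of a plane annihilated by the minimal polynomial of `γ` makes the plane a line
  over `L = 𝔽_p[γ]`, so every oriented necklace of `V` is the image of `v` under some linear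
  isomorphism `L ≃ V` (`exists_map_eq_of_isOrientedNecklace`).
* A linear automorphism `f` of `L` fixes `v` if and only if it commutes with `γ` up to a scalar
  `a ∈ 𝔽_p`. Then `a γ` is conjugate to `γ`, hence equal to `γ` or `γ ^ p`, and comparing orders
  gives `a = 1`: so `f` is `L`-linear, a multiplication by a unit (`map_eq_self_iff`).
* If `f` normalises the group of these multiplications then `f γ f⁻¹` is `γ` or `γ ^ p`. Since
  `γ ^ (p + 1) ∈ 𝔽_p`, the latter turns the lines backwards, so `f v` is `v` or `w v`
  (`map_eq_self_or_w_of_intertwine`). Conversely `v` and `w v` have the same stabiliser, so whatever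
  preserves `{v, w v}` normalises it (`map_basisMulEquiv_eq_self_or_w_iff`).

In the basis `(1, α)` of `L` the multiplications by units form the non-split Cartan subgroup
attached to `(1 : α)` (`IsNonsplitCartan.exists_basis`). The map `Φ_E` sends a basis of `E[p]` to the
image of `v` under the isomorphism `L ≃ E[p]` carrying `(1, α)` to that basis. The bijections on
modular curves follow formally (`ModularCurvePoints.exists_equiv`).

An oriented necklace of `E` comes with a basis of `E[p]`, namely the one in which a characteristic
polynomial is computed, so no further information on the structure of `E[p]` enters.
-/

namespace NonsplitCartan

/-! ### Pearls as lines -/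

section Lines

variable {p : ℕ} [Fact p.Prime] {V V' : Type u} [AddCommGroup V] [Module (ZMod p) V]
  [AddCommGroup V'] [Module (ZMod p) V']

lemma addOrderOf_eq_of_ne_zero {x : V} (hx : x ≠ 0) : addOrderOf x = p :=
  addOrderOf_eq_prime (by rw [← Nat.cast_smul_eq_nsmul (ZMod p), CharP.cast_eq_zero, zero_smul]) hx

/-- The line `𝔽_p x` through a nonzero vector `x`, as a cyclic subgroup of order `p`. -/
def Pearl.line (x : V) (hx : x ≠ 0) : Pearl p V :=
  ⟨AddSubgroup.zmultiples x, inferInstance, by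
    rw [Nat.card_zmultiples, addOrderOf_eq_of_ne_zero (p := p) hx]⟩

lemma mem_zmultiples_iff_smul {x y : V} :
    y ∈ AddSubgroup.zmultiples x ↔ ∃ a : ZMod p, y = a • x := by
  rw [AddSubgroup.mem_zmultiples_iff]
  constructor
  · rintro ⟨n, rfl⟩
    exact ⟨n, (Int.cast_smul_eq_zsmul (ZMod p) n x).symm⟩
  · rintro ⟨a, rfl⟩
    obtain ⟨n, rfl⟩ := ZMod.intCast_surjective a
    exact ⟨n, (Int.cast_smul_eq_zsmul (ZMod p) n x).symm⟩

lemma Pearl.line_eq_iff {x y : V} (hx : x ≠ 0) (hy : y ≠ 0) :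
    (Pearl.line x hx : Pearl p V) = Pearl.line y hy ↔ ∃ a : ZMod p, x = a • y := by
  constructor
  · intro h
    have hm : x ∈ AddSubgroup.zmultiples y := by
      have := congrArg Subtype.val h
      change AddSubgroup.zmultiples x = AddSubgroup.zmultiples y at this
      exact this ▸ AddSubgroup.mem_zmultiples x
    exact mem_zmultiples_iff_smul.mp hm
  · rintro ⟨a, rfl⟩
    have ha : a ≠ 0 := by rintro rfl; simp at hx
    refine Subtype.ext (le_antisymm ?_ ?_) <;> refine AddSubgroup.zmultiples_le_of_mem ?_
    · exact mem_zmultiples_iff_smul.mpr ⟨a, rfl⟩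
    · exact mem_zmultiples_iff_smul.mpr ⟨a⁻¹, by rw [inv_smul_smul₀ ha]⟩

lemma Pearl.exists_eq_line (C : Pearl p V) : ∃ (x : V) (hx : x ≠ 0), C = Pearl.line x hx := by
  obtain ⟨x, hx⟩ := AddSubgroup.isAddCyclic_iff_exists_zmultiples_eq_top C.1 |>.mp C.2.1
  refine ⟨x, ?_, Subtype.ext hx.symm⟩
  rintro rfl
  have h := C.2.2
  rw [← hx, AddSubgroup.zmultiples_zero_eq_bot, AddSubgroup.card_bot] at h
  exact (Fact.out : p.Prime).one_lt.ne h

@[simp]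
lemma Pearl.map_line (f : V ≃ₗ[ZMod p] V') (x : V) (hx : x ≠ 0) :
    (Pearl.line x hx : Pearl p V).map f = Pearl.line (f x) (f.map_ne_zero_iff.mpr hx) :=
  Subtype.ext (AddMonoidHom.map_zmultiples _ x)

lemma Pearl.congr_eq_of_smul {f f' : V ≃ₗ[ZMod p] V'} (a : ZMod p) (h : ∀ x, f x = a • f' x) :
    Pearl.congr f = Pearl.congr f' := by
  refine Equiv.ext fun C => ?_
  obtain ⟨x, hx, rfl⟩ := C.exists_eq_line
  change Pearl.map f _ = Pearl.map f' _
  rw [map_line, map_line, line_eq_iff]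
  exact ⟨a, h x⟩

lemma Pearl.congr_eq_iff {f f' : V ≃ₗ[ZMod p] V'} :
    Pearl.congr f = Pearl.congr f' ↔ ∃ a : ZMod p, ∀ x, f x = a • f' x := by
  refine ⟨fun h => ?_, fun ⟨a, ha⟩ => congr_eq_of_smul a ha⟩
  -- `f'⁻¹ f` preserves every line, so it is a homothety
  obtain ⟨a, ha⟩ := LinearMap.exists_eq_smul_id_of_forall_notLinearIndependent
    (f := (f.trans f'.symm : V →ₗ[ZMod p] V)) fun x => by
      by_cases hx : x = 0
      · exact fun hi => hi.ne_zero 0 hx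
      have hC : Pearl.map f (Pearl.line x hx) = Pearl.map f' (Pearl.line x hx) :=
        congrArg (fun e => e (Pearl.line x hx)) h
      rw [map_line, map_line, line_eq_iff] at hC
      obtain ⟨a, ha⟩ := hC
      rw [LinearIndependent.pair_iff' hx]
      push Not
      exact ⟨a, by simp [ha]⟩
  refine ⟨a, fun x => ?_⟩
  have := congrArg f' (LinearMap.congr_fun ha x)
  simpa using this

end Lines

/-! ### The rotation attached to a cyclic list -/

section Rotation

variable {p : ℕ} {V V' : Type u} [AddCommGroup V] [AddCommGroup V']

/-- The permutation of the pearls moving each entry of a cyclic list to the next one. -/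
def CyclicList.rotation : CyclicList p V → Equiv.Perm (Pearl p V) :=
  Quotient.lift (fun C : PearlList p V => C.symm.trans ((Equiv.addRight 1).trans C)) (by
    rintro C C' ⟨j, h⟩
    refine Equiv.ext fun x => ?_
    obtain ⟨i, rfl⟩ := C'.surjective x
    have hx : C'.symm (C (i + j)) = i := by rw [← h, Equiv.symm_apply_apply]
    simp [hx, h, add_right_comm])

@[simp]
lemma CyclicList.rotation_mk_apply (C : PearlList p V) (i : Fin (p + 1)) :
    CyclicList.rotation (Quotient.mk _ C) (C i) = C (i + 1) := by
  simp [rotation]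

/-- A cyclic list is determined by its rotation: both lists are obtained by iterating the same
permutation, from different starting points. -/
lemma CyclicList.rotation_injective :
    Function.Injective (CyclicList.rotation : CyclicList p V → Equiv.Perm (Pearl p V)) := by
  rintro ⟨C⟩ ⟨D⟩ h
  obtain ⟨j, hj⟩ := C.surjective (D 0)
  refine Quotient.sound ⟨j, fun i => ?_⟩
  induction i using Fin.induction with
  | zero => rw [zero_add, hj]
  | succ i ih =>
    have hD := CyclicList.rotation_mk_apply D i.castSucc
    have hC := CyclicList.rotation_mk_apply C (i.castSucc + j)
    rw [Fin.coeSucc_eq_succ] at hD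
    rw [← hD, ih, ← Fin.coeSucc_eq_succ, add_right_comm, ← hC]
    exact congrArg (fun e : Equiv.Perm (Pearl p V) => e (C (i.castSucc + j))) h.symm

/-- The condition that a permutation `T` moves `C i` to `C (i + 1)` for `i < p` forces
`T (C p) = C 0`. -/
lemma CyclicList.rotation_mk_eq_iff (C : PearlList p V) (T : Equiv.Perm (Pearl p V)) :
    CyclicList.rotation (Quotient.mk _ C) = T ↔ ∀ i : Fin p, T (C i.castSucc) = C i.succ := by
  constructor
  · rintro rfl i
    rw [rotation_mk_apply, Fin.coeSucc_eq_succ]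
  · intro h
    refine Equiv.ext fun x => ?_
    obtain ⟨i, rfl⟩ := C.surjective x
    rw [rotation_mk_apply]
    induction i using Fin.lastCases with
    | cast i => rw [h, Fin.coeSucc_eq_succ]
    | last =>
      rw [Fin.last_add_one]
      obtain ⟨k, hk⟩ := C.surjective (T (C (Fin.last p)))
      induction k using Fin.cases with
      | zero => exact hk
      | succ k =>
        rw [← h k] at hk
        exact absurd (C.injective (T.injective hk)) (Fin.castSucc_lt_last k).ne

lemma CyclicList.rotation_w (v : CyclicList p V) : v.w.rotation = v.rotation.symm := by
  obtain ⟨C⟩ := v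
  refine (CyclicList.rotation_mk_eq_iff (Fin.revPerm.trans C) _).mpr fun i => ?_
  rw [Equiv.symm_apply_eq]
  change _ = rotation (Quotient.mk _ C) (C i.succ.rev)
  rw [rotation_mk_apply, Fin.rev_succ, Fin.coeSucc_eq_succ, ← Fin.rev_castSucc]
  rfl

lemma CyclicList.w_w (v : CyclicList p V) : v.w.w = v :=
  rotation_injective (by rw [rotation_w, rotation_w, Equiv.symm_symm])

lemma CyclicList.w_injective : Function.Injective (CyclicList.w : CyclicList p V → _) :=
  Function.LeftInverse.injective w_w

variable [Module (ZMod p) V] [Module (ZMod p) V']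

lemma CyclicList.rotation_map (f : V ≃ₗ[ZMod p] V') (v : CyclicList p V) :
    (v.map f).rotation = (Pearl.congr f).symm.trans (v.rotation.trans (Pearl.congr f)) := by
  obtain ⟨C⟩ := v
  rfl

lemma Pearl.congr_trans {V'' : Type u} [AddCommGroup V''] [Module (ZMod p) V'']
    (f : V ≃ₗ[ZMod p] V') (f' : V' ≃ₗ[ZMod p] V'') :
    Pearl.congr (f.trans f') = (Pearl.congr f).trans (Pearl.congr f') :=
  Equiv.ext fun C => C.map_trans f f'

lemma CyclicList.rotation_map_of_eq_congr {v : CyclicList p V} {h : V ≃ₗ[ZMod p] V}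
    (hv : v.rotation = Pearl.congr h) (f : V ≃ₗ[ZMod p] V') :
    (v.map f).rotation = Pearl.congr (f.symm.trans (h.trans f)) := by
  rw [rotation_map, hv, Pearl.congr_trans, Pearl.congr_trans]
  rfl

lemma isOrientedNecklace_iff [Fact p.Prime] {γ : (GaloisField p 2)ˣ} {v : CyclicList p V} :
    IsOrientedNecklace γ v ↔ ∃ h : V ≃ₗ[ZMod p] V, InClass γ h ∧ v.rotation = Pearl.congr h := by
  constructor
  · rintro ⟨C, rfl, h, hh, hC⟩
    exact ⟨h, hh, (CyclicList.rotation_mk_eq_iff C _).mpr hC⟩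
  · rintro ⟨h, hh, hv⟩
    obtain ⟨C, rfl⟩ := Quotient.exists_rep v
    exact ⟨C, rfl, h, hh, (CyclicList.rotation_mk_eq_iff C _).mp hv⟩

lemma OrientedNecklace.toNecklace_eq_iff [Fact p.Prime] {γ : (GaloisField p 2)ˣ}
    {v v' : OrientedNecklace p V γ} :
    v.toNecklace = v'.toNecklace ↔ v.1 = v'.1 ∨ v.1 = v'.1.w := by
  constructor
  · intro h
    have hm : v.1 ∈ v'.toNecklace.1 := h ▸ Set.mem_insert v.1 _
    exact hm
  · rintro (h | h)
    · exact congrArg toNecklace (Subtype.ext h)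
    · refine Subtype.ext ?_
      change {v.1, v.1.w} = ({v'.1, v'.1.w} : Set _)
      rw [h, CyclicList.w_w, Set.pair_comm]

lemma OrientedNecklace.toNecklace_map [Fact p.Prime] {γ : (GaloisField p 2)ˣ}
    (f : V ≃ₗ[ZMod p] V') (v : OrientedNecklace p V γ) :
    v.toNecklace.map f = (v.map f).toNecklace := by
  refine Subtype.ext ?_
  change CyclicList.map f '' {v.1, v.1.w} = {v.1.map f, (v.1.map f).w}
  rw [Set.image_pair, CyclicList.map_w]

end Rotation

/-! ### A generator of the multiplicative group of a quadratic extension of `𝔽_p` -/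

section Field

variable {p : ℕ} [Fact p.Prime] {L : Type u} [Field L] [Algebra (ZMod p) L] {g : Lˣ}

lemma finite_of_finrank_eq_two (hL : Module.finrank (ZMod p) L = 2) : Finite L :=
  have : Module.Finite (ZMod p) L := Module.finite_of_finrank_pos (by omega)
  Module.finite_of_finite (ZMod p)

lemma natCard_of_finrank_eq_two (hL : Module.finrank (ZMod p) L = 2) : Nat.card L = p ^ 2 := by
  have := finite_of_finrank_eq_two hL
  rw [Module.natCard_eq_pow_finrank (K := ZMod p), Nat.card_zmod, hL]

lemma orderOf_generator (hL : Module.finrank (ZMod p) L = 2)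
    (hg : ∀ x : Lˣ, x ∈ Subgroup.zpowers g) : orderOf g = p ^ 2 - 1 := by
  rw [orderOf_eq_card_of_forall_mem_zpowers hg, Nat.card_units, natCard_of_finrank_eq_two hL]

/-- Two powers `g ^ i`, `g ^ j` with `i ≤ j < i + p + 1` are proportional over `𝔽_p` only if
`i = j`: otherwise the order of `g` would divide `(j - i) (p - 1) < p ^ 2 - 1`. -/
lemma eq_of_pow_eq_smul_pow (hL : Module.finrank (ZMod p) L = 2)
    (hg : ∀ x : Lˣ, x ∈ Subgroup.zpowers g) {i j : ℕ} (hij : i ≤ j) (hj : j < i + (p + 1))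
    {a : ZMod p} (ha : (g : L) ^ j = a • (g : L) ^ i) : i = j := by
  have hp := (Fact.out : p.Prime).two_le
  obtain ⟨d, rfl⟩ := Nat.exists_eq_add_of_le hij
  rw [pow_add, mul_comm, Algebra.smul_def, mul_left_inj' (pow_ne_zero _ g.ne_zero)] at ha
  have ha0 : a ≠ 0 := by
    rintro rfl
    rw [map_zero] at ha
    exact pow_ne_zero d g.ne_zero ha
  have h1 : g ^ (d * (p - 1)) = 1 := by
    refine Units.ext ?_
    rw [Units.val_pow_eq_pow_val, pow_mul, ha, ← map_pow, ZMod.pow_card_sub_one_eq_one ha0,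
      map_one, Units.val_one]
  have h2 := orderOf_dvd_of_pow_eq_one h1
  have h3 : p ^ 2 - 1 = (p + 1) * (p - 1) := by
    simpa using Nat.sq_sub_sq p 1
  rw [orderOf_generator hL hg, h3] at h2
  have h4 := Nat.dvd_of_mul_dvd_mul_right (by omega) h2
  have h5 : d = 0 := Nat.eq_zero_of_dvd_of_lt h4 (by omega)
  omega

lemma exists_generator_pow_eq (hL : Module.finrank (ZMod p) L = 2) :
    ∃ a : ZMod p, (g : L) ^ (p + 1) = algebraMap (ZMod p) L a := by
  have := finite_of_finrank_eq_two hL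
  refine ⟨Algebra.norm (ZMod p) (g : L), ?_⟩
  have hp := (Fact.out : p.Prime).two_le
  have h3 : p ^ 2 - 1 = (p + 1) * (p - 1) := by
    simpa using Nat.sq_sub_sq p 1
  rw [FiniteField.algebraMap_norm_eq_pow, natCard_of_finrank_eq_two hL, Nat.card_zmod, h3,
    Nat.mul_div_cancel _ (by omega)]

lemma exists_pow_eq (hL : Module.finrank (ZMod p) L = 2)
    (hg : ∀ x : Lˣ, x ∈ Subgroup.zpowers g) {x : L} (hx : x ≠ 0) : ∃ n : ℕ, x = (g : L) ^ n := by
  have := finite_of_finrank_eq_two hL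
  obtain ⟨n, hn⟩ := mem_powers_iff_mem_zpowers.mpr (hg (Units.mk0 x hx))
  exact ⟨n, by simpa using congrArg Units.val hn.symm⟩

lemma adjoin_generator_eq_top (hL : Module.finrank (ZMod p) L = 2)
    (hg : ∀ x : Lˣ, x ∈ Subgroup.zpowers g) : Algebra.adjoin (ZMod p) {(g : L)} = ⊤ := by
  refine eq_top_iff.mpr fun x _ => ?_
  by_cases hx : x = 0
  · exact hx ▸ zero_mem _
  · obtain ⟨n, rfl⟩ := exists_pow_eq hL hg hx
    exact pow_mem (Algebra.self_mem_adjoin_singleton _ _) n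

lemma isIntegral_of_finrank_eq_two (hL : Module.finrank (ZMod p) L = 2) (x : L) :
    IsIntegral (ZMod p) x :=
  have := finite_of_finrank_eq_two hL
  Algebra.IsIntegral.isIntegral x

lemma minpoly_eq_charpoly_of_generator (hL : Module.finrank (ZMod p) L = 2)
    (hg : ∀ x : Lˣ, x ∈ Subgroup.zpowers g) (b : Module.Basis (Fin 2) (ZMod p) L) :
    (LinearMap.toMatrix b b (LinearMap.mulLeft (ZMod p) (g : L))).charpoly =
      minpoly (ZMod p) (g : L) := by
  have := finite_of_finrank_eq_two hL
  let B := PowerBasis.ofAdjoinEqTop (isIntegral_of_finrank_eq_two hL (g : L))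
    (adjoin_generator_eq_top hL hg)
  have hB : B.gen = (g : L) := PowerBasis.ofAdjoinEqTop_gen _ _
  rw [LinearMap.charpoly_toMatrix, ← LinearMap.charpoly_toMatrix _ B.basis, ← hB,
    ← charpoly_leftMulMatrix]
  rfl

/-- A conjugate of `g` over `𝔽_p` is `g` or its image `g ^ p` under Frobenius. -/
lemma eq_or_eq_pow_of_aeval_minpoly (hL : Module.finrank (ZMod p) L = 2) {d : L}
    (hd : Polynomial.aeval d (minpoly (ZMod p) (g : L)) = 0) : d = g ∨ d = (g : L) ^ p := by
  have := finite_of_finrank_eq_two hL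
  have hm : minpoly (ZMod p) (g : L) = minpoly (ZMod p) d :=
    minpoly.eq_of_irreducible_of_monic (minpoly.irreducible (isIntegral_of_finrank_eq_two hL _)) hd
      (minpoly.monic (isIntegral_of_finrank_eq_two hL _))
  obtain ⟨s, hs⟩ := isConjRoot_iff_exists_algEquiv.mp hm.symm
  obtain ⟨n, hn⟩ := (FiniteField.bijective_frobeniusAlgEquivOfAlgebraic_pow (ZMod p) L).2 s
  obtain ⟨n, hn2⟩ := n
  rw [hL] at hn2
  rw [← hs, ← hn]
  interval_cases n
  · left; simp
  · right; simp [ZMod.card]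

/-- No scalar multiple of a generator `g` other than `g` itself is conjugate to `g`. -/
lemma smul_generator_eq_of_aeval_minpoly (hL : Module.finrank (ZMod p) L = 2)
    (hg : ∀ x : Lˣ, x ∈ Subgroup.zpowers g) {a : ZMod p}
    (ha : Polynomial.aeval (a • (g : L)) (minpoly (ZMod p) (g : L)) = 0) :
    a • (g : L) = g := by
  rcases eq_or_eq_pow_of_aeval_minpoly hL ha with h | h
  · exact h
  · have hp := (Fact.out : p.Prime).two_le
    have := eq_of_pow_eq_smul_pow hL hg (i := 1) (j := p) (by omega) (by omega)
      (a := a) (by rw [pow_one, h])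
    omega

/-- If `f` intertwines multiplication by `g` and by `d`, then `g` and `d` are conjugate. -/
lemma aeval_minpoly_eq_zero_of_intertwine (f : L ≃ₗ[ZMod p] L) {d : L}
    (hf : ∀ x, f (g * x) = d * f x) : Polynomial.aeval d (minpoly (ZMod p) (g : L)) = 0 := by
  have h : ∀ q : Polynomial (ZMod p), ∀ x, f (Polynomial.aeval (g : L) q * x) =
      Polynomial.aeval d q * f x := by
    intro q
    induction q using Polynomial.induction_on' with
    | add q r hq hr => intro x; simp only [map_add, add_mul, hq, hr]
    | monomial n a =>
      intro x
      rw [Polynomial.aeval_monomial, Polynomial.aeval_monomial, mul_assoc, mul_assoc,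
        ← Algebra.smul_def, ← Algebra.smul_def, map_smul]
      congr 1
      induction n with
      | zero => simp
      | succ n ih => rw [pow_succ', pow_succ', mul_assoc, mul_assoc, hf, ih]
  have h1 := h (minpoly (ZMod p) (g : L)) (f.symm 1)
  rw [minpoly.aeval, zero_mul, map_zero, f.apply_symm_apply, mul_one] at h1
  exact h1.symm

/-- A plane with an endomorphism `h` annihilated by the minimal polynomial of a generator `g` of
`L` is a one-dimensional `L`-vector space on which `g` acts as `h`. -/
lemma exists_linearEquiv_intertwine (hL : Module.finrank (ZMod p) L = 2)
    (hg : ∀ x : Lˣ, x ∈ Subgroup.zpowers g) {V : Type u} [AddCommGroup V] [Module (ZMod p) V]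
    (hV : Module.finrank (ZMod p) V = 2) (h : Module.End (ZMod p) V)
    (hh : Polynomial.aeval h (minpoly (ZMod p) (g : L)) = 0) :
    ∃ f : L ≃ₗ[ZMod p] V, ∀ x, f (g * x) = h (f x) := by
  have := finite_of_finrank_eq_two hL
  have : Module.Finite (ZMod p) V := Module.finite_of_finrank_pos (by omega)
  have : Nontrivial V := Module.nontrivial_of_finrank_pos (R := ZMod p) (by omega)
  let B := PowerBasis.ofAdjoinEqTop (isIntegral_of_finrank_eq_two hL (g : L))
    (adjoin_generator_eq_top hL hg)
  have hB : B.gen = (g : L) := PowerBasis.ofAdjoinEqTop_gen _ _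
  let r : L →ₐ[ZMod p] Module.End (ZMod p) V := B.lift h (by rw [hB]; exact hh)
  have hr : r g = h := by rw [← hB]; exact B.lift_gen h _
  obtain ⟨v, hv⟩ := exists_ne (0 : V)
  have hinj : Function.Injective (LinearMap.applyₗ v ∘ₗ r.toLinearMap) := by
    refine (injective_iff_map_eq_zero _).mpr fun x hx => ?_
    by_contra hx0
    refine hv ?_
    have hx' : r x v = 0 := hx
    have h1 : r x⁻¹ (r x v) = v := by
      rw [← Module.End.mul_apply, ← map_mul, inv_mul_cancel₀ hx0, map_one, Module.End.one_apply]
    rw [← h1, hx', map_zero]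
  refine ⟨LinearMap.linearEquivOfInjective _ hinj (hL.trans hV.symm), fun x => ?_⟩
  change r (g * x) v = h (r x v)
  rw [map_mul, hr, Module.End.mul_apply]

end Field

/-! ### The standard necklace of a quadratic extension of `𝔽_p` -/

section StandardNecklace

variable {p : ℕ} [Fact p.Prime] {L : Type u} [Field L] [Algebra (ZMod p) L] {g : Lˣ}

variable (p) in
/-- Multiplication by a unit of `L`, as an `𝔽_p`-linear automorphism of `L`. -/
def mulEquiv (c : Lˣ) : L ≃ₗ[ZMod p] L :=
  DistribMulAction.toLinearEquiv (ZMod p) L c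

@[simp]
lemma mulEquiv_apply (c : Lˣ) (x : L) : mulEquiv p c x = c * x := rfl

@[simp]
lemma mulEquiv_symm_apply (c : Lˣ) (x : L) : (mulEquiv p c).symm x = (c : L)⁻¹ * x := by
  rw [LinearEquiv.symm_apply_eq, mulEquiv_apply, mul_inv_cancel_left₀ c.ne_zero]

/-- The lines spanned by `1, g, …, g ^ p` are all the lines of `L`, each occurring once. -/
lemma bijective_line_pow (hL : Module.finrank (ZMod p) L = 2)
    (hg : ∀ x : Lˣ, x ∈ Subgroup.zpowers g) :
    Function.Bijective (fun i : Fin (p + 1) =>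
      (Pearl.line ((g : L) ^ (i : ℕ)) (pow_ne_zero _ g.ne_zero) : Pearl p L)) := by
  constructor
  · intro i j hij
    have hi := i.2
    have hj := j.2
    rcases le_total (i : ℕ) j with h | h
    · obtain ⟨a, ha⟩ := (Pearl.line_eq_iff _ _).mp hij.symm
      exact Fin.ext (eq_of_pow_eq_smul_pow hL hg h (by omega) ha)
    · obtain ⟨a, ha⟩ := (Pearl.line_eq_iff _ _).mp hij
      exact (Fin.ext (eq_of_pow_eq_smul_pow hL hg h (by omega) ha)).symm
  · intro C
    obtain ⟨x, hx, rfl⟩ := C.exists_eq_line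
    obtain ⟨n, rfl⟩ := exists_pow_eq hL hg hx
    obtain ⟨a, ha⟩ := exists_generator_pow_eq (g := g) hL
    refine ⟨⟨n % (p + 1), Nat.mod_lt _ (Nat.succ_pos p)⟩, Eq.symm ?_⟩
    refine (Pearl.line_eq_iff _ _).mpr ⟨a ^ (n / (p + 1)), ?_⟩
    rw [Algebra.smul_def, map_pow, ← ha, ← pow_mul, ← pow_add, Nat.div_add_mod]

/-- Multiplication by a generator permutes the lines of `L` in a single cycle. -/
lemma exists_rotation_eq_congr_mulEquiv (hL : Module.finrank (ZMod p) L = 2)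
    (hg : ∀ x : Lˣ, x ∈ Subgroup.zpowers g) :
    ∃ v : CyclicList p L, v.rotation = Pearl.congr (mulEquiv p g) := by
  refine ⟨Quotient.mk _ (Equiv.ofBijective _ (bijective_line_pow hL hg)), ?_⟩
  rw [CyclicList.rotation_mk_eq_iff]
  intro i
  change Pearl.map (mulEquiv p g) (Pearl.line ((g : L) ^ (i : ℕ)) (pow_ne_zero _ g.ne_zero)) =
    Pearl.line ((g : L) ^ (i + 1 : ℕ)) (pow_ne_zero _ g.ne_zero)
  rw [Pearl.map_line]
  congr 1
  rw [mulEquiv_apply, pow_succ']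

variable {γ : (GaloisField p 2)ˣ}

lemma inClass_mulEquiv (hL : Module.finrank (ZMod p) L = 2)
    (hg : ∀ x : Lˣ, x ∈ Subgroup.zpowers g)
    (hγ : minpoly (ZMod p) (g : L) = minpoly (ZMod p) (γ : GaloisField p 2)) :
    InClass γ (mulEquiv p g) := by
  have := finite_of_finrank_eq_two hL
  let b := Module.finBasisOfFinrankEq (ZMod p) L hL
  refine ⟨b, 1, ?_⟩
  rw [Units.val_one, one_smul, ← hγ, ← minpoly_eq_charpoly_of_generator hL hg b]
  rfl

/-- A linear automorphism of `L` fixing the standard necklace is multiplication by a unit: it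
conjugates multiplication by `g` to multiplication by some `a g` with `a ∈ 𝔽_p`, and `a = 1`
because `a g` is then conjugate to `g`. -/
lemma map_eq_self_iff (hL : Module.finrank (ZMod p) L = 2)
    (hg : ∀ x : Lˣ, x ∈ Subgroup.zpowers g) {v : CyclicList p L}
    (hv : v.rotation = Pearl.congr (mulEquiv p g)) (f : L ≃ₗ[ZMod p] L) :
    v.map f = v ↔ ∃ c : Lˣ, ∀ x, f x = c * x := by
  rw [← CyclicList.rotation_injective.eq_iff, CyclicList.rotation_map_of_eq_congr hv, hv,
    Pearl.congr_eq_iff]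
  constructor
  · rintro ⟨a, ha⟩
    have hf : ∀ x, f (g * x) = (a • (g : L)) * f x := fun x => by
      simpa using ha (f x)
    have hag := smul_generator_eq_of_aeval_minpoly hL hg
      (aeval_minpoly_eq_zero_of_intertwine f hf)
    rw [hag] at hf
    have hpow : ∀ n : ℕ, f ((g : L) ^ n) = (g : L) ^ n * f 1 := by
      intro n
      induction n with
      | zero => simp
      | succ n ih => rw [pow_succ', hf, ih, mul_assoc]
    refine ⟨Units.mk0 (f 1) (f.map_ne_zero_iff.mpr one_ne_zero), fun x => ?_⟩
    by_cases hx : x = 0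
    · simp [hx]
    · obtain ⟨n, rfl⟩ := exists_pow_eq hL hg hx
      rw [hpow, mul_comm, Units.val_mk0]
  · rintro ⟨c, hc⟩
    refine ⟨1, fun x => ?_⟩
    have := hc (f.symm x)
    rw [f.apply_symm_apply] at this
    simp only [LinearEquiv.trans_apply, mulEquiv_apply, one_smul, hc]
    rw [mul_left_comm, ← this]

/-- `g ^ p` turns the lines of `L` backwards, as `g ^ p * g` is a scalar. -/
lemma congr_mulEquiv_pow (hL : Module.finrank (ZMod p) L = 2) :
    Pearl.congr (mulEquiv p (g ^ p)) = (Pearl.congr (mulEquiv p g)).symm := by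
  obtain ⟨a, ha⟩ := exists_generator_pow_eq (g := g) hL
  refine Pearl.congr_eq_of_smul (f' := (mulEquiv p g).symm) a fun x => ?_
  rw [mulEquiv_apply, mulEquiv_symm_apply, Algebra.smul_def, ← ha, Units.val_pow_eq_pow_val,
    pow_succ, mul_assoc, mul_inv_cancel_left₀ g.ne_zero]

/-- A linear automorphism of `L` conjugating multiplication by `g` to multiplication by an
element `d` of `L` preserves the standard necklace up to orientation: `d` is `g` or `g ^ p`. -/
lemma map_eq_self_or_w_of_intertwine (hL : Module.finrank (ZMod p) L = 2) {v : CyclicList p L}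
    (hv : v.rotation = Pearl.congr (mulEquiv p g)) (f : L ≃ₗ[ZMod p] L) {d : L}
    (hf : ∀ x, f (g * x) = d * f x) : v.map f = v ∨ v.map f = v.w := by
  have hfd : ∀ x, f (g * f.symm x) = d * x := fun x => by rw [hf, f.apply_symm_apply]
  rcases eq_or_eq_pow_of_aeval_minpoly hL (aeval_minpoly_eq_zero_of_intertwine f hf) with rfl | rfl
  · left
    rw [← CyclicList.rotation_injective.eq_iff, CyclicList.rotation_map_of_eq_congr hv, hv]
    exact congrArg Pearl.congr (LinearEquiv.ext hfd)
  · right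
    rw [← CyclicList.rotation_injective.eq_iff, CyclicList.rotation_map_of_eq_congr hv,
      CyclicList.rotation_w, hv, ← congr_mulEquiv_pow hL]
    refine congrArg Pearl.congr (LinearEquiv.ext fun x => ?_)
    rw [mulEquiv_apply, Units.val_pow_eq_pow_val]
    exact hfd x

/-- Every oriented necklace is the image of the standard one under a linear isomorphism. -/
lemma exists_map_eq_of_isOrientedNecklace (hL : Module.finrank (ZMod p) L = 2)
    (hg : ∀ x : Lˣ, x ∈ Subgroup.zpowers g)
    (hγ : minpoly (ZMod p) (g : L) = minpoly (ZMod p) (γ : GaloisField p 2))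
    {v : CyclicList p L} (hv : v.rotation = Pearl.congr (mulEquiv p g))
    {V : Type u} [AddCommGroup V] [Module (ZMod p) V] {v' : CyclicList p V}
    (hv' : IsOrientedNecklace γ v') : ∃ f : L ≃ₗ[ZMod p] V, v.map f = v' := by
  obtain ⟨h, ⟨b, c, hb⟩, hr⟩ := isOrientedNecklace_iff.mp hv'
  have : Module.Finite (ZMod p) V := .of_basis b
  rw [LinearMap.charpoly_toMatrix, ← hγ] at hb
  obtain ⟨f, hf⟩ := exists_linearEquiv_intertwine hL hg
    (by rw [Module.finrank_eq_card_basis b, Fintype.card_fin]) ((c : ZMod p) • (h : V →ₗ[ZMod p] V))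
    (by rw [← hb]; exact LinearMap.aeval_self_charpoly _)
  refine ⟨f, CyclicList.rotation_injective ?_⟩
  rw [CyclicList.rotation_map_of_eq_congr hv, hr]
  refine Pearl.congr_eq_of_smul (c : ZMod p) fun x => ?_
  simp [hf]

end StandardNecklace

/-! ### Matrices acting on a plane through a basis -/

section BasisMulEquiv

variable {p : ℕ} {V V' : Type u} [AddCommGroup V] [Module (ZMod p) V] [AddCommGroup V']
  [Module (ZMod p) V']

lemma exists_eq_basisMul (b b' : Module.Basis (Fin 2) (ZMod p) V) :
    ∃ M : GL (Fin 2) (ZMod p), b' = basisMul b M := by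
  refine ⟨(Matrix.GeneralLinearGroup.toLin' b).symm
    ((LinearMap.GeneralLinearGroup.generalLinearEquiv (ZMod p) V).symm
      (b.equiv b' (Equiv.refl _))), ?_⟩
  refine Module.Basis.eq_of_apply_eq fun j => ?_
  rw [basisMul, MulEquiv.apply_symm_apply, MulEquiv.apply_symm_apply]
  simp

/-- The automorphism of a plane with matrix `M` in the basis `b`. -/
noncomputable def basisMulEquiv (b : Module.Basis (Fin 2) (ZMod p) V) (M : GL (Fin 2) (ZMod p)) :
    V ≃ₗ[ZMod p] V :=
  b.equiv (basisMul b M) (Equiv.refl _)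

@[simp]
lemma basisMulEquiv_apply (b : Module.Basis (Fin 2) (ZMod p) V) (M : GL (Fin 2) (ZMod p))
    (j : Fin 2) : basisMulEquiv b M (b j) = basisMul b M j := by
  simp [basisMulEquiv]

lemma equiv_basisMul (b : Module.Basis (Fin 2) (ZMod p) V) (b' : Module.Basis (Fin 2) (ZMod p) V')
    (M : GL (Fin 2) (ZMod p)) :
    b.equiv (basisMul b' M) (Equiv.refl _) =
      (basisMulEquiv b M).trans (b.equiv b' (Equiv.refl _)) := by
  refine b.ext' fun j => ?_
  simp [basisMul_apply]

lemma basisMulEquiv_mul (b : Module.Basis (Fin 2) (ZMod p) V) (M N : GL (Fin 2) (ZMod p)) :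
    basisMulEquiv b (M * N) = (basisMulEquiv b N).trans (basisMulEquiv b M) := by
  rw [basisMulEquiv, basisMul_mul, equiv_basisMul]
  rfl

lemma exists_basisMulEquiv_eq (b : Module.Basis (Fin 2) (ZMod p) V) (f : V ≃ₗ[ZMod p] V) :
    ∃ M : GL (Fin 2) (ZMod p), basisMulEquiv b M = f := by
  obtain ⟨M, hM⟩ := exists_eq_basisMul b (b.map f)
  refine ⟨M, b.ext' fun j => ?_⟩
  rw [basisMulEquiv_apply, ← hM, Module.Basis.map_apply]

lemma CyclicList.map_injective (f : V ≃ₗ[ZMod p] V') :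
    Function.Injective (CyclicList.map f : CyclicList p V → CyclicList p V') := fun v w h => by
  have h' := congrArg (CyclicList.map f.symm) h
  rwa [← map_trans, ← map_trans, LinearEquiv.self_trans_symm, map_refl, map_refl] at h'

end BasisMulEquiv

/-! ### Stabilisers of the standard necklace -/

section Stabiliser

variable {p : ℕ} [Fact p.Prime] {L : Type u} [Field L] [Algebra (ZMod p) L] {g : Lˣ}
  {H : Subgroup (GL (Fin 2) (ZMod p))}

/-- In the basis `(1, α)` of the quadratic field, the stabiliser of `(1 : α)` consists of the
matrices of the multiplications by units. The field is lifted to an arbitrary universe. -/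
lemma IsNonsplitCartan.exists_basis (hH : IsNonsplitCartan p H) :
    ∃ b : Module.Basis (Fin 2) (ZMod p) (ULift.{u} (GaloisField p 2)),
      ∀ M : GL (Fin 2) (ZMod p), M ∈ H ↔
        ∃ c : (ULift.{u} (GaloisField p 2))ˣ, ∀ x, basisMulEquiv b M x = c * x := by
  obtain ⟨α, hα, hM⟩ := hH
  have hli : LinearIndependent (ZMod p) ![(1 : GaloisField p 2), α] := by
    rw [LinearIndependent.pair_iff' one_ne_zero]
    exact fun a ha => hα ⟨a, by rw [← ha, Algebra.smul_def, mul_one]⟩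
  let b₀ := basisOfLinearIndependentOfCardEqFinrank hli
    (by rw [Fintype.card_fin, GaloisField.finrank p two_ne_zero])
  have hb₀ : ∀ j, b₀ j = ![(1 : GaloisField p 2), α] j := fun j => by
    simp [b₀]
  let e : ULift.{u} (GaloisField p 2) ≃ₐ[ZMod p] GaloisField p 2 := ULift.algEquiv
  let b := b₀.map e.symm.toLinearEquiv
  have hb : ∀ j, e (b j) = ![(1 : GaloisField p 2), α] j := fun j => by
    simp [b, hb₀]
  refine ⟨b, fun M => (hM M).trans ?_⟩
  have hvec : ∀ j, e (basisMulEquiv b M (b j)) =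
      Matrix.vecMul ![1, α] (M.1.map (algebraMap (ZMod p) (GaloisField p 2))) j := fun j => by
    rw [basisMulEquiv_apply, basisMul_apply, map_add, map_smul, map_smul, hb, hb]
    simp [Matrix.vecMul, dotProduct, Algebra.smul_def, mul_comm]
  constructor
  · rintro ⟨c, hc⟩
    refine ⟨Units.map (e.symm : _ →* _) c, fun x => ?_⟩
    have : basisMulEquiv b M = mulEquiv p (Units.map (e.symm : _ →* _) c) := by
      refine b.ext' fun j => e.injective ?_
      rw [hvec, hc, mulEquiv_apply, map_mul, hb]
      simp
    rw [this, mulEquiv_apply]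
  · rintro ⟨c, hc⟩
    refine ⟨Units.map (e : _ →* _) c, funext fun j => ?_⟩
    rw [← hvec, hc, map_mul, hb]
    simp

variable {b : Module.Basis (Fin 2) (ZMod p) L} {v : CyclicList p L}

lemma map_basisMulEquiv_eq_self_iff (hL : Module.finrank (ZMod p) L = 2)
    (hg : ∀ x : Lˣ, x ∈ Subgroup.zpowers g) (hv : v.rotation = Pearl.congr (mulEquiv p g))
    (hH : ∀ M : GL (Fin 2) (ZMod p), M ∈ H ↔ ∃ c : Lˣ, ∀ x, basisMulEquiv b M x = c * x)
    (M : GL (Fin 2) (ZMod p)) : v.map (basisMulEquiv b M) = v ↔ M ∈ H := by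
  rw [hH, map_eq_self_iff hL hg hv]

/-- The stabiliser of the pair `{v, w v}` is the normaliser of the stabiliser of `v`. -/
lemma map_basisMulEquiv_eq_self_or_w_iff (hL : Module.finrank (ZMod p) L = 2)
    (hg : ∀ x : Lˣ, x ∈ Subgroup.zpowers g) (hv : v.rotation = Pearl.congr (mulEquiv p g))
    (hH : ∀ M : GL (Fin 2) (ZMod p), M ∈ H ↔ ∃ c : Lˣ, ∀ x, basisMulEquiv b M x = c * x)
    (M : GL (Fin 2) (ZMod p)) :
    v.map (basisMulEquiv b M) = v ∨ v.map (basisMulEquiv b M) = v.w ↔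
      M ∈ Subgroup.normalizer (H : Set (GL (Fin 2) (ZMod p))) := by
  have hstab := map_basisMulEquiv_eq_self_iff hL hg hv hH
  constructor
  · intro h
    -- `v` and `w v` have the same stabiliser, and so has the image of `v` under `M`
    have hstab' : ∀ Y, (v.map (basisMulEquiv b M)).map (basisMulEquiv b Y) =
        v.map (basisMulEquiv b M) ↔ Y ∈ H := fun Y => by
      rcases h with h | h <;> rw [h]
      · exact hstab Y
      · rw [CyclicList.map_w, CyclicList.w_injective.eq_iff, hstab]
    refine Subgroup.mem_normalizer_iff.mpr fun X => ?_
    rw [← hstab, ← hstab' (M * X * M⁻¹), ← CyclicList.map_trans, ← basisMulEquiv_mul,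
      inv_mul_cancel_right, basisMulEquiv_mul, CyclicList.map_trans,
      (CyclicList.map_injective _).eq_iff]
  · intro h
    obtain ⟨A, hA⟩ := exists_basisMulEquiv_eq b (mulEquiv p g)
    have hAH : A ∈ H := (hH A).mpr ⟨g, fun x => by rw [hA, mulEquiv_apply]⟩
    obtain ⟨d, hd⟩ := (hH _).mp ((Subgroup.mem_normalizer_iff.mp h A).mp hAH)
    refine map_eq_self_or_w_of_intertwine hL hv (basisMulEquiv b M) (d := d) fun x => ?_
    rw [← hd, ← mulEquiv_apply (p := p), ← hA, ← LinearEquiv.trans_apply, ← LinearEquiv.trans_apply,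
      ← basisMulEquiv_mul, ← basisMulEquiv_mul, inv_mul_cancel_right]

end Stabiliser

/-! ### Points of modular curves -/

section ModularCurvePoints

variable {p : ℕ} {k : Type u} [Field k] [DecidableEq k]

lemma ModularCurvePoints.mk_eq_mk_iff {G : Subgroup (GL (Fin 2) (ZMod p))} {E E' : EllipticCurve k}
    {b : LevelBasis p E} {b' : LevelBasis p E'} :
    ModularCurvePoints.mk p G E b = ModularCurvePoints.mk p G E' b' ↔
      ∃ f : E.Iso E', ∃ M ∈ G, b' = basisMul (b.map (f.torsion p)) M := by
  have hsmul : ∀ M : GL (Fin 2) (ZMod p), MulOpposite.op M • FullLevel.mk p E b =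
      FullLevel.mk p E' b' ↔ ∃ f : E.Iso E', b' = basisMul (b.map (f.torsion p)) M := fun M => by
    change FullLevel.mk p E (basisMul b M) = _ ↔ _
    refine Quotient.eq.trans ?_
    change (∃ f : E.Iso E', (basisMul b M).map (f.torsion p) = b') ↔ _
    simp only [basisMul_map, eq_comm]
  rw [eq_comm]
  refine Quotient.eq.trans ?_
  rw [MulAction.orbitRel_apply, MulAction.mem_orbit_iff]
  constructor
  · rintro ⟨⟨M, hM⟩, h⟩
    obtain ⟨f, hf⟩ := (hsmul M.unop).mp h
    exact ⟨f, M.unop, hM, hf⟩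
  · rintro ⟨f, M, hM, h⟩
    exact ⟨⟨MulOpposite.op M, hM⟩, (hsmul M).mpr ⟨f, h⟩⟩

/-- A surjective invariant of elliptic curves with a level basis which separates exactly the
`G`-orbits of isomorphism classes identifies its target with the points of `Y_G`. -/
lemma ModularCurvePoints.exists_equiv (G : Subgroup (GL (Fin 2) (ZMod p))) {Q : Type u}
    (F : ∀ E : EllipticCurve k, LevelBasis p E → Q) (hF : ∀ q, ∃ E b, F E b = q)
    (hF' : ∀ (E E' : EllipticCurve k) (b : LevelBasis p E) (b' : LevelBasis p E'),
      F E b = F E' b' ↔ ∃ f : E.Iso E', ∃ M ∈ G, b' = basisMul (b.map (f.torsion p)) M) :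
    ∃ e : ModularCurvePoints p k G ≃ Q, ∀ E b, e (ModularCurvePoints.mk p G E b) = F E b := by
  have hrep : ∀ x : ModularCurvePoints p k G, ∃ y : Σ E : EllipticCurve k, LevelBasis p E,
      ModularCurvePoints.mk p G y.1 y.2 = x := by
    rintro ⟨⟨y⟩⟩
    exact ⟨y, rfl⟩
  choose r hr using hrep
  have he : ∀ E b, F (r (ModularCurvePoints.mk p G E b)).1 (r (ModularCurvePoints.mk p G E b)).2 =
      F E b := fun E b => (hF' _ _ _ _).mpr (mk_eq_mk_iff.mp (hr _))
  refine ⟨Equiv.ofBijective (fun x => F (r x).1 (r x).2) ⟨fun x y hxy => ?_, fun q => ?_⟩, he⟩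
  · rw [← hr x, ← hr y]
    exact mk_eq_mk_iff.mpr ((hF' _ _ _ _).mp hxy)
  · obtain ⟨E, b, rfl⟩ := hF q
    exact ⟨ModularCurvePoints.mk p G E b, he E b⟩

end ModularCurvePoints

end NonsplitCartan

/-! ### Necklaces and non-split Cartan modular curves -/

theorem mainTheorem3 {k : Type u} [Field k] [IsAlgClosed k] [DecidableEq k]
    (p : ℕ) [Fact p.Prime] (hp : p ≠ 2) (hpk : (p : k) ≠ 0)
    (γ : (GaloisField p 2)ˣ) (hγ : ∀ x : (GaloisField p 2)ˣ, x ∈ Subgroup.zpowers γ)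
    (H : Subgroup (GL (Fin 2) (ZMod p))) (hH : IsNonsplitCartan p H) :
    ∃ Φ : ∀ E : EllipticCurve k, LevelBasis p E → OrientedNecklace p (Torsion p E.Point) γ,
      (∀ (E E' : EllipticCurve k) (g : Torsion p E.Point ≃ₗ[ZMod p] Torsion p E'.Point)
        (b : LevelBasis p E), Φ E' (b.map g) = (Φ E b).map g) ∧
      (∀ E : EllipticCurve k, Function.Surjective (Φ E)) ∧
      (∀ (E : EllipticCurve k) (b b' : LevelBasis p E),
        Φ E b = Φ E b' ↔ ∃ M ∈ H, b' = basisMul b M) ∧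
      (∀ (E : EllipticCurve k) (b b' : LevelBasis p E),
        (Φ E b).toNecklace = (Φ E b').toNecklace ↔
          ∃ M ∈ Subgroup.normalizer (H : Set (GL (Fin 2) (ZMod p))), b' = basisMul b M) ∧
      (∃ e : ModularCurvePoints p k H ≃ OrientedNecklaceClass γ k,
        ∀ (E : EllipticCurve k) (b : LevelBasis p E),
          e (ModularCurvePoints.mk p H E b) = OrientedNecklaceClass.mk E (Φ E b)) ∧
      (∃ e : ModularCurvePoints p k (Subgroup.normalizer (H : Set (GL (Fin 2) (ZMod p)))) ≃
          NecklaceClass γ k,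
        ∀ (E : EllipticCurve k) (b : LevelBasis p E),
          e (ModularCurvePoints.mk p (Subgroup.normalizer (H : Set (GL (Fin 2) (ZMod p)))) E b) =
            NecklaceClass.mk E (Φ E b).toNecklace) := by
  let L := ULift.{u} (GaloisField p 2)
  let e : L ≃ₐ[ZMod p] GaloisField p 2 := ULift.algEquiv
  let g : Lˣ := Units.map (e.symm : GaloisField p 2 →* L) γ
  have hL : Module.finrank (ZMod p) L = 2 :=
    e.toLinearEquiv.finrank_eq.trans (GaloisField.finrank p two_ne_zero)
  have hg : ∀ x : Lˣ, x ∈ Subgroup.zpowers g := fun x => by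
    obtain ⟨n, hn⟩ := hγ (Units.map (e : L →* GaloisField p 2) x)
    refine ⟨n, Units.ext ?_⟩
    have hx : Units.map (e.symm : GaloisField p 2 →* L) (Units.map (e : L →* GaloisField p 2) x) =
        x := Units.ext (e.symm_apply_apply x)
    simp only [g]
    rw [← map_zpow, ← hx]
    exact congrArg (fun y => (Units.map (e.symm : GaloisField p 2 →* L) y : L)) hn
  have hmin : minpoly (ZMod p) (g : L) = minpoly (ZMod p) (γ : GaloisField p 2) :=
    minpoly.algEquiv_eq e.symm (γ : GaloisField p 2)
  obtain ⟨β, hβ⟩ := hH.exists_basis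
  obtain ⟨v, hv⟩ := exists_rotation_eq_congr_mulEquiv hL hg
  have hnv : IsOrientedNecklace γ v :=
    isOrientedNecklace_iff.mpr ⟨mulEquiv p g, inClass_mulEquiv hL hg hmin, hv⟩
  let v₀ : OrientedNecklace p L γ := ⟨v, hnv⟩
  let Φ : ∀ E : EllipticCurve k, LevelBasis p E → OrientedNecklace p (Torsion p E.Point) γ :=
    fun E b => OrientedNecklace.map (β.equiv b (Equiv.refl _)) v₀
  have hmap : ∀ (E E' : EllipticCurve k) (f : Torsion p E.Point ≃ₗ[ZMod p] Torsion p E'.Point)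
      (b : LevelBasis p E), Φ E' (b.map f) = (Φ E b).map f := fun E E' f b => by
    have hf : β.equiv (b.map f) (Equiv.refl _) = (β.equiv b (Equiv.refl _)).trans f :=
      β.ext' fun j => by simp
    simp only [Φ]
    rw [hf]
    exact OrientedNecklace.map_trans _ _ v₀
  have hsurj : ∀ E : EllipticCurve k, Function.Surjective (Φ E) := fun E v' => by
    obtain ⟨f, hf⟩ := exists_map_eq_of_isOrientedNecklace hL hg hmin hv v'.2
    refine ⟨β.map f, Subtype.ext ?_⟩
    have hf' : β.equiv (β.map f) (Equiv.refl _) = f := β.ext' fun j => by simp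
    change v.map (β.equiv (β.map f) (Equiv.refl _)) = v'.1
    rw [hf', hf]
  have hΦ : ∀ (E : EllipticCurve k) (b : LevelBasis p E) (M : GL (Fin 2) (ZMod p)),
      (Φ E (basisMul b M)).1 = (v.map (basisMulEquiv β M)).map (β.equiv b (Equiv.refl _)) :=
    fun E b M => by
      change v.map (β.equiv (basisMul b M) (Equiv.refl _)) = _
      rw [equiv_basisMul, CyclicList.map_trans]
  have hori : ∀ (E : EllipticCurve k) (b b' : LevelBasis p E),
      Φ E b = Φ E b' ↔ ∃ M ∈ H, b' = basisMul b M := fun E b b' => by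
    have key : ∀ M, Φ E b = Φ E (basisMul b M) ↔ M ∈ H := fun M => by
      rw [eq_comm, ← map_basisMulEquiv_eq_self_iff hL hg hv hβ]
      refine Subtype.ext_iff.trans ?_
      rw [hΦ]
      exact (CyclicList.map_injective _).eq_iff
    constructor
    · intro h
      obtain ⟨M, rfl⟩ := exists_eq_basisMul b b'
      exact ⟨M, (key M).mp h, rfl⟩
    · rintro ⟨M, hM, rfl⟩
      exact (key M).mpr hM
  have hneck : ∀ (E : EllipticCurve k) (b b' : LevelBasis p E),
      (Φ E b).toNecklace = (Φ E b').toNecklace ↔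
        ∃ M ∈ Subgroup.normalizer (H : Set (GL (Fin 2) (ZMod p))), b' = basisMul b M :=
    fun E b b' => by
      have key : ∀ M, (Φ E b).toNecklace = (Φ E (basisMul b M)).toNecklace ↔
          M ∈ Subgroup.normalizer (H : Set (GL (Fin 2) (ZMod p))) := fun M => by
        rw [eq_comm, OrientedNecklace.toNecklace_eq_iff, hΦ,
          ← map_basisMulEquiv_eq_self_or_w_iff hL hg hv hβ]
        change _ = v.map _ ∨ _ = (v.map _).w ↔ _
        rw [← CyclicList.map_w, (CyclicList.map_injective _).eq_iff,
          (CyclicList.map_injective _).eq_iff]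
      constructor
      · intro h
        obtain ⟨M, rfl⟩ := exists_eq_basisMul b b'
        exact ⟨M, (key M).mp h, rfl⟩
      · rintro ⟨M, hM, rfl⟩
        exact (key M).mpr hM
  refine ⟨Φ, hmap, hsurj, hori, hneck, ?_, ?_⟩
  · refine ModularCurvePoints.exists_equiv H (fun E b => OrientedNecklaceClass.mk E (Φ E b))
      ?_ fun E E' b b' => Quotient.eq.trans (exists_congr fun f => ?_)
    · rintro ⟨E, v'⟩
      obtain ⟨b, rfl⟩ := hsurj E v'
      exact ⟨E, b, rfl⟩
    · change (Φ E b).map (f.torsion p) = Φ E' b' ↔ _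
      rw [← hmap, hori]
  · refine ModularCurvePoints.exists_equiv _ (fun E b => NecklaceClass.mk E (Φ E b).toNecklace)
      ?_ fun E E' b b' => Quotient.eq.trans (exists_congr fun f => ?_)
    · rintro ⟨E, s, v', hv', rfl⟩
      obtain ⟨b, hb⟩ := hsurj E ⟨v', hv'⟩
      refine ⟨E, b, ?_⟩
      rw [hb]
      rfl
    · change (Φ E b).toNecklace.map (f.torsion p) = (Φ E' b').toNecklace ↔ _
      rw [OrientedNecklace.toNecklace_map, ← hmap, hneck]
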